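/- Let $\Gamma$ be a discrete group and let $\ell\colon\Gamma\to[0,\infty)$ be a length function, i.e. $\ell(e)=0$, $\ell(\gamma^{-1})=\ell(\gamma)$ and $\ell(\gamma\eta)\le \ell(\gamma)+\ell(\eta)$ for all $\gamma,\eta\in\Gamma$. $\Gamma$ has the Rapid Decay Property (RD) with respect to $\ell$ if there are $C>0$ and an integer $p\ge 0$ such that \[ \|\varphi\|_{C_r^*(\Gamma)}\le C\Big(\sum_{\gamma\in\Gamma}|\varphi(\gamma)|^2(1+\ell(\gamma))^{2p}\Big)^{1/2} \] for all finitely supported $\varphi\colon\Gamma\to\mathbb C$, where $\|\varphi\|_{C_r^*(\Gamma)}$ is the norm of left convolution by $\varphi$ on $\ell^2(\Gamma)$. An action $\alpha$ of $\Gamma$ on a $C^*$-algebra $A$ has RD with respect to $\ell$ if there are $C>0$ and an integer $p\ge 0$ such that, for all finitely supported $f\colon\Gamma\to A$, \[ \|f\|_{A\rtimes_{\alpha,r}\Gamma}\le C\max\Big\{\Big\|\sum_{\gamma}\alpha_{\gamma^{-1}}\big(f(\gamma)^*f(\gamma)\big)(1+\ell(\gamma))^{2p}\Big\|^{1/2},\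 \Big\|\sum_{\gamma}f(\gamma)f(\gamma)^*(1+\ell(\gamma))^{2p}\Big\|^{1/2}\Big\}, \] where $\|\cdot\|_{A\rtimes_{\alpha,r}\Gamma}$ is the reduced crossed product norm, that is, the norm of left convolution by $f$ on the Hilbert $A$-module completing $C_c(\Gamma,A)$ for $\langle\xi,\eta\rangle=\sum_\gamma\alpha_{\gamma^{-1}}(\xi(\gamma)^*\eta(\gamma))$, the convolution being determined by $(a\delta_\gamma)(b\delta_\eta)=a\,\alpha_\gamma(b)\,\delta_{\gamma\eta}$. Then: (1) If $\Gamma$ has RD with respect to $\ell$, then for every locally compact Hausdorff space $X$ the trivial action of $\Gamma$ on $C_0(X)$ has RD with respect to $\ell$. (2) For every nonempty compact Hausdorff space $X$, the trivial action of $\Gamma$ on $C(X)$ has RD with respect to $\ell$ if and only if $\Gamma$ has RD with respect to $\ell$. -/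

import Mathlib

noncomputable section

namespace RapidDecay

/-- Length functions on a discrete group. -/
structure IsLengthFunction {Γ : Type*} [Group Γ] (ℓ : Γ → ℝ) : Prop where
  nonneg : ∀ γ, 0 ≤ ℓ γ
  map_one : ℓ 1 = 0
  map_inv : ∀ γ, ℓ γ⁻¹ = ℓ γ
  map_mul_le : ∀ γ η, ℓ (γ * η) ≤ ℓ γ + ℓ η

/-! ### The reduced norm on `C_c(Γ)` and Rapid Decay of a group -/

section Scalar

variable {Γ : Type*} [Group Γ]

/-- The Hilbert space `ℓ²(Γ)`. -/
abbrev EllTwo (Γ : Type*) : Type _ := lp (fun _ : Γ => ℂ) 2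

/-- Left translation by a group element preserves square summability. -/
theorem memℓp_translate (γ : Γ) (ξ : EllTwo Γ) :
    Memℓp (fun η : Γ => (ξ : Γ → ℂ) (γ⁻¹ * η)) 2 := by
  have h2 : 0 < (2 : ENNReal).toReal := by norm_num
  rw [memℓp_gen_iff h2]
  exact (Equiv.mulLeft γ⁻¹).summable_iff.mpr ((memℓp_gen_iff h2).mp (lp.memℓp ξ))

/-- The left regular representation: `(λ_γ ξ)(η) = ξ(γ⁻¹ η)`, an isometry of `ℓ²(Γ)`. -/
def leftTranslation (γ : Γ) : EllTwo Γ →ₗᵢ[ℂ] EllTwo Γ where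
  toFun ξ := ⟨fun η => (ξ : Γ → ℂ) (γ⁻¹ * η), memℓp_translate γ ξ⟩
  map_add' _ _ := rfl
  map_smul' _ _ := rfl
  norm_map' ξ := by
    have h2 : 0 < (2 : ENNReal).toReal := by norm_num
    rw [lp.norm_eq_tsum_rpow h2, lp.norm_eq_tsum_rpow h2]
    exact congrArg (· ^ (1 / (2 : ENNReal).toReal))
      ((Equiv.mulLeft γ⁻¹).tsum_eq fun η => ‖(ξ : Γ → ℂ) η‖ ^ (2 : ENNReal).toReal)

/-- The operator `λ(φ) = ∑ φ(γ) λ_γ` on `ℓ²(Γ)`, for finitely supported `φ`. -/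
def leftRegular (φ : Γ →₀ ℂ) : EllTwo Γ →L[ℂ] EllTwo Γ :=
  φ.sum fun γ c => c • (leftTranslation γ).toContinuousLinearMap

/-- The norm of `C_r^*(Γ)` on `C_c(Γ)`: the operator norm in the left regular representation. -/
def groupReducedNorm (φ : Γ →₀ ℂ) : ℝ := ‖leftRegular φ‖

/-- `(∑ |φ(γ)|² (1 + ℓ(γ))^{2p})^{1/2}`. -/
def groupSobolevNorm (ℓ : Γ → ℝ) (p : ℕ) (φ : Γ →₀ ℂ) : ℝ :=
  Real.sqrt (φ.sum fun γ c => ‖c‖ ^ 2 * (1 + ℓ γ) ^ (2 * p))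

/-- Rapid Decay of the discrete group `Γ` with respect to `ℓ`. -/
def GroupHasRD (ℓ : Γ → ℝ) : Prop :=
  ∃ C : ℝ, 0 < C ∧ ∃ p : ℕ, ∀ φ : Γ →₀ ℂ, groupReducedNorm φ ≤ C * groupSobolevNorm ℓ p φ

end Scalar

/-! ### The Fell bundle of an action on a C⋆-algebra and its Rapid Decay

An action of `Γ` on `A` is a homomorphism `α : Γ →* (A ≃⋆ₐ[ℂ] A)`. Finitely supported sections of
the associated Fell bundle `⊔ A δ_γ` are finitely supported functions `Γ →₀ A`. -/

section Action

variable {Γ : Type*} [Group Γ] {A : Type*} [NonUnitalCStarAlgebra A]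

/-- Convolution in `C_c(Γ, A)`, determined by `(a δ_γ)(b δ_η) = a α_γ(b) δ_{γη}`. -/
def convolution (α : Γ →* (A ≃⋆ₐ[ℂ] A)) (f g : Γ →₀ A) : Γ →₀ A :=
  f.sum fun γ a => g.sum fun η b => Finsupp.single (γ * η) (a * α γ b)

/-- The `A`-valued inner product `⟨ξ, η⟩ = ∑ ξ(γ)^* η(γ)`, the products being taken in the Fell
bundle; it makes `C_c(Γ, A)` a dense submodule of the regular Hilbert module of the bundle. -/
def regularInner (α : Γ →* (A ≃⋆ₐ[ℂ] A)) (ξ η : Γ →₀ A) : A :=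
  ξ.sum fun γ a => α γ⁻¹ (star a * η γ)

/-- The norm of the regular Hilbert module. -/
def regularModuleNorm (α : Γ →* (A ≃⋆ₐ[ℂ] A)) (ξ : Γ →₀ A) : ℝ :=
  Real.sqrt ‖regularInner α ξ ξ‖

/-- The reduced norm of `f ∈ C_c(Γ, A)`, i.e. its norm in `A ⋊_{α,r} Γ`: the operator norm of left
convolution by `f` on the regular Hilbert module, computed on the dense submodule `C_c(Γ, A)`. -/
def reducedNorm (α : Γ →* (A ≃⋆ₐ[ℂ] A)) (f : Γ →₀ A) : ENNReal :=
  ⨆ (ξ : Γ →₀ A) (_ : regularModuleNorm α ξ ≤ 1),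
    ENNReal.ofReal (regularModuleNorm α (convolution α f ξ))

/-- `‖∑ α_{γ⁻¹}(f(γ)^* f(γ)) (1 + ℓ(γ))^{2p}‖^{1/2}`. -/
def sobolevNormSource (α : Γ →* (A ≃⋆ₐ[ℂ] A)) (ℓ : Γ → ℝ) (p : ℕ) (f : Γ →₀ A) : ℝ :=
  Real.sqrt ‖f.sum fun γ a => (((1 + ℓ γ) ^ (2 * p) : ℝ) : ℂ) • α γ⁻¹ (star a * a)‖

/-- `‖∑ f(γ) f(γ)^* (1 + ℓ(γ))^{2p}‖^{1/2}`. -/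
def sobolevNormRange (ℓ : Γ → ℝ) (p : ℕ) (f : Γ →₀ A) : ℝ :=
  Real.sqrt ‖f.sum fun γ a => (((1 + ℓ γ) ^ (2 * p) : ℝ) : ℂ) • (a * star a)‖

/-- The Sobolev norm `‖f‖_{2,p,ℓ}`, the maximum of its source and range versions. -/
def sobolevNorm (α : Γ →* (A ≃⋆ₐ[ℂ] A)) (ℓ : Γ → ℝ) (p : ℕ) (f : Γ →₀ A) : ℝ :=
  max (sobolevNormSource α ℓ p f) (sobolevNormRange ℓ p f)

/-- Rapid Decay of an action (that is, of its Fell bundle) with respect to `ℓ`. -/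
def ActionHasRD (α : Γ →* (A ≃⋆ₐ[ℂ] A)) (ℓ : Γ → ℝ) : Prop :=
  ∃ C : ℝ, 0 < C ∧ ∃ p : ℕ, ∀ f : Γ →₀ A,
    reducedNorm α f ≤ ENNReal.ofReal (C * sobolevNorm α ℓ p f)

/-- The trivial action of `Γ` on `A`: every group element acts by the identity. -/
def trivialAction (Γ : Type*) [Group Γ] (A : Type*) [NonUnitalCStarAlgebra A] :
    Γ →* (A ≃⋆ₐ[ℂ] A) := 1

end Action

end RapidDecay

end

/-! For the trivial action, a ⋆-homomorphism `χ : A → B` applied to coefficients commutes with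
convolution, the inner product and the weighted sums, and it is contractive. If a family of such
maps detects the norm of `A`, the RD inequality for `B` therefore gives the one for `A`, with the
same `C` and `p` (`ActionHasRD.of_norming`). Point evaluations detect the sup norm, which passes RD
from `ℂ` to `C₀(X)` and `C(X)`. Constants embed `ℂ` isometrically in `C(X)` for `X` nonempty, which
gives the converse. Over `ℂ`, RD of the trivial action is RD of the group
(`actionHasRD_complex_iff`). -/

noncomputable section

namespace RapidDecay

/-! ### Functoriality in the coefficient algebra -/

section TrivialAction

variable {Γ : Type*} {A B : Type*} [NonUnitalCStarAlgebra A] [NonUnitalCStarAlgebra B]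

/-- The pointwise action of a ⋆-homomorphism on finitely supported functions. -/
def mapCoeff (Γ : Type*) (χ : A →⋆ₙₐ[ℂ] B) : (Γ →₀ A) →+ (Γ →₀ B) :=
  Finsupp.mapRange.addMonoidHom (χ : A →+ B)

@[simp]
theorem mapCoeff_apply (χ : A →⋆ₙₐ[ℂ] B) (f : Γ →₀ A) (γ : Γ) :
    mapCoeff Γ χ f γ = χ (f γ) := rfl

@[simp]
theorem mapCoeff_single (χ : A →⋆ₙₐ[ℂ] B) (γ : Γ) (a : A) :
    mapCoeff Γ χ (Finsupp.single γ a) = Finsupp.single γ (χ a) :=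
  Finsupp.mapRange_single (hf := map_zero χ)

theorem sum_mapCoeff {M : Type*} [AddCommMonoid M] (χ : A →⋆ₙₐ[ℂ] B) (f : Γ →₀ A)
    (h : Γ → B → M) (h0 : ∀ γ, h γ 0 = 0) :
    (mapCoeff Γ χ f).sum h = f.sum fun γ a => h γ (χ a) :=
  Finsupp.sum_mapRange_index (hf := map_zero χ) h0

variable [Group Γ]

@[simp]
theorem trivialAction_apply (γ : Γ) (a : A) : trivialAction Γ A γ a = a := rfl

@[simp]
theorem trivialAction_inv_apply (γ : Γ) (a : A) : (trivialAction Γ A γ)⁻¹ a = a := rfl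

/-- Every `χ` is equivariant for trivial actions, so multiplicativity suffices. -/
theorem convolution_mapCoeff (χ : A →⋆ₙₐ[ℂ] B) (f g : Γ →₀ A) :
    convolution (trivialAction Γ B) (mapCoeff Γ χ f) (mapCoeff Γ χ g) =
      mapCoeff Γ χ (convolution (trivialAction Γ A) f g) := by
  unfold convolution
  rw [sum_mapCoeff _ _ _ (by simp), map_finsuppSum]
  refine Finsupp.sum_congr fun γ _ => ?_
  rw [sum_mapCoeff _ _ _ (by simp), map_finsuppSum]
  simp [-Finsupp.single_mul]

theorem regularInner_mapCoeff (χ : A →⋆ₙₐ[ℂ] B) (ξ η : Γ →₀ A) :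
    regularInner (trivialAction Γ B) (mapCoeff Γ χ ξ) (mapCoeff Γ χ η) =
      χ (regularInner (trivialAction Γ A) ξ η) := by
  unfold regularInner
  rw [sum_mapCoeff _ _ _ (by simp), map_finsuppSum]
  simp [map_star]

theorem regularModuleNorm_mapCoeff (χ : A →⋆ₙₐ[ℂ] B) (ξ : Γ →₀ A) :
    regularModuleNorm (trivialAction Γ B) (mapCoeff Γ χ ξ) =
      √‖χ (regularInner (trivialAction Γ A) ξ ξ)‖ := by
  rw [regularModuleNorm, regularInner_mapCoeff]

theorem sobolevNorm_mapCoeff (χ : A →⋆ₙₐ[ℂ] B) (ℓ : Γ → ℝ) (p : ℕ) (f : Γ →₀ A) :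
    sobolevNorm (trivialAction Γ B) ℓ p (mapCoeff Γ χ f) =
      max
        √‖χ (f.sum fun γ a => (((1 + ℓ γ) ^ (2 * p) : ℝ) : ℂ) •
          trivialAction Γ A γ⁻¹ (star a * a))‖
        √‖χ (f.sum fun γ a => (((1 + ℓ γ) ^ (2 * p) : ℝ) : ℂ) • (a * star a))‖ := by
  unfold sobolevNorm sobolevNormSource sobolevNormRange
  rw [sum_mapCoeff _ _ _ (by simp), sum_mapCoeff _ _ _ (by simp), map_finsuppSum, map_finsuppSum]
  simp [map_star]

theorem regularModuleNorm_mapCoeff_le (χ : A →⋆ₙₐ[ℂ] B) (ξ : Γ →₀ A) :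
    regularModuleNorm (trivialAction Γ B) (mapCoeff Γ χ ξ) ≤
      regularModuleNorm (trivialAction Γ A) ξ := by
  rw [regularModuleNorm_mapCoeff]
  exact Real.sqrt_le_sqrt (NonUnitalStarAlgHom.norm_apply_le χ _)

theorem sobolevNorm_mapCoeff_le (χ : A →⋆ₙₐ[ℂ] B) (ℓ : Γ → ℝ) (p : ℕ) (f : Γ →₀ A) :
    sobolevNorm (trivialAction Γ B) ℓ p (mapCoeff Γ χ f) ≤
      sobolevNorm (trivialAction Γ A) ℓ p f := by
  rw [sobolevNorm_mapCoeff]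
  exact max_le_max (Real.sqrt_le_sqrt (NonUnitalStarAlgHom.norm_apply_le χ _))
    (Real.sqrt_le_sqrt (NonUnitalStarAlgHom.norm_apply_le χ _))

theorem sobolevNorm_nonneg (α : Γ →* (A ≃⋆ₐ[ℂ] A)) (ℓ : Γ → ℝ) (p : ℕ) (f : Γ →₀ A) :
    0 ≤ sobolevNorm α ℓ p f :=
  le_max_of_le_left (Real.sqrt_nonneg _)

/-- A bound on the reduced norm is a bound on left convolution on the unit ball. -/
theorem reducedNorm_le_ofReal_iff (α : Γ →* (A ≃⋆ₐ[ℂ] A)) (f : Γ →₀ A) {K : ℝ} (hK : 0 ≤ K) :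
    reducedNorm α f ≤ ENNReal.ofReal K ↔
      ∀ ξ, regularModuleNorm α ξ ≤ 1 → regularModuleNorm α (convolution α f ξ) ≤ K := by
  simp only [reducedNorm, iSup_le_iff, ENNReal.ofReal_le_ofReal_iff hK]

/-- Rapid Decay of the trivial action passes to a C⋆-algebra normed by ⋆-homomorphisms. -/
theorem ActionHasRD.of_norming {ℓ : Γ → ℝ} (h : ActionHasRD (trivialAction Γ B) ℓ)
    {X : Type*} (χ : X → A →⋆ₙₐ[ℂ] B)
    (hχ : ∀ (a : A) (r : ℝ), 0 ≤ r → (∀ x, ‖χ x a‖ ≤ r) → ‖a‖ ≤ r) :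
    ActionHasRD (trivialAction Γ A) ℓ := by
  obtain ⟨C, hC, p, h⟩ := h
  refine ⟨C, hC, p, fun f => ?_⟩
  have hK : 0 ≤ C * sobolevNorm (trivialAction Γ A) ℓ p f :=
    mul_nonneg hC.le (sobolevNorm_nonneg _ _ _ _)
  rw [reducedNorm_le_ofReal_iff _ _ hK]
  intro ξ hξ
  -- The family norms elements of `A`, so it is applied to the inner product itself, with the
  -- squared bound.
  refine Real.sqrt_le_iff.mpr ⟨hK, hχ _ _ (sq_nonneg _) fun x => ?_⟩
  refine (Real.sqrt_le_left hK).mp ?_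
  rw [← regularModuleNorm_mapCoeff, ← convolution_mapCoeff]
  -- Contractivity enters twice: the image of `ξ` stays in the unit ball, and the Sobolev norm of
  -- `f` does not grow.
  refine ((reducedNorm_le_ofReal_iff _ _ (mul_nonneg hC.le (sobolevNorm_nonneg _ _ _ _))).mp
    (h (mapCoeff Γ (χ x) f)) _ ((regularModuleNorm_mapCoeff_le _ _).trans hξ)).trans ?_
  exact mul_le_mul_of_nonneg_left (sobolevNorm_mapCoeff_le _ _ _ _) hC.le

/-- Rapid Decay of the trivial action passes to C⋆-subalgebras. -/
theorem ActionHasRD.of_isometric {ℓ : Γ → ℝ} (h : ActionHasRD (trivialAction Γ B) ℓ)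
    (χ : A →⋆ₙₐ[ℂ] B) (hχ : ∀ a, ‖χ a‖ = ‖a‖) : ActionHasRD (trivialAction Γ A) ℓ :=
  h.of_norming (fun _ : Unit => χ) fun a _ _ ha => hχ a ▸ ha ()

end TrivialAction

/-! ### Comparison with `ℓ²(Γ)` for scalar coefficients -/

section Scalar

variable {Γ : Type*}

/-- Finitely supported functions as vectors of `ℓ²(Γ)`. -/
def toEllTwo (ψ : Γ →₀ ℂ) : EllTwo Γ :=
  ⟨fun γ => ψ γ, Memℓp.of_exponent_ge (memℓp_zero ψ.hasFiniteSupport) zero_le⟩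

@[simp]
theorem toEllTwo_apply (ψ : Γ →₀ ℂ) (γ : Γ) : (toEllTwo ψ : Γ → ℂ) γ = ψ γ := rfl

theorem toEllTwo_smul (c : ℂ) (ψ : Γ →₀ ℂ) : toEllTwo (c • ψ) = c • toEllTwo ψ := rfl

/-- The truncations of `v` to finite sets converge to `v`. -/
theorem denseRange_toEllTwo : DenseRange (toEllTwo : (Γ →₀ ℂ) → EllTwo Γ) := by
  classical
  intro v
  refine mem_closure_of_tendsto (lp.hasSum_single (by norm_num) v) (.of_forall fun s => ?_)
  refine ⟨∑ γ ∈ s, Finsupp.single γ (v γ), ?_⟩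
  ext η
  rw [lp.coeFn_sum, Finset.sum_apply, toEllTwo_apply, Finsupp.finsetSum_apply]
  simp [Finsupp.single_apply, Pi.single_apply, eq_comm]

variable [Group Γ]

theorem norm_toEllTwo (ψ : Γ →₀ ℂ) :
    ‖toEllTwo ψ‖ = regularModuleNorm (trivialAction Γ ℂ) ψ := by
  have h : regularInner (trivialAction Γ ℂ) ψ ψ = ((‖toEllTwo ψ‖ ^ 2 : ℝ) : ℂ) := by
    have h2 : 0 < (2 : ENNReal).toReal := by norm_num
    have := lp.norm_rpow_eq_tsum h2 (toEllTwo ψ)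
    simp only [ENNReal.toReal_ofNat, Real.rpow_ofNat, toEllTwo_apply] at this
    rw [this, tsum_eq_sum (s := ψ.support) (by simp), regularInner, Finsupp.sum]
    push_cast
    refine Finset.sum_congr rfl fun γ _ => ?_
    simpa using Complex.conj_mul' (ψ γ)
  rw [regularModuleNorm, h, Complex.norm_real, Real.norm_of_nonneg (sq_nonneg _),
    Real.sqrt_sq (norm_nonneg _)]

theorem leftRegular_toEllTwo (φ ψ : Γ →₀ ℂ) :
    leftRegular φ (toEllTwo ψ) = toEllTwo (convolution (trivialAction Γ ℂ) φ ψ) := by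
  classical
  ext η
  simp only [leftRegular, convolution, Finsupp.sum, sum_apply, lp.coeFn_sum,
    Finset.sum_apply, toEllTwo_apply, Finsupp.finsetSum_apply]
  refine Finset.sum_congr rfl fun γ _ => ?_
  have hmul : ∀ x, (γ * x = η) = (x = γ⁻¹ * η) := fun x => propext eq_inv_mul_iff_mul_eq.symm
  have htranslate : (leftTranslation γ (toEllTwo ψ) : Γ → ℂ) η = ψ (γ⁻¹ * η) := rfl
  -- Only the term at `γ⁻¹ * η` can contribute, and it occurs in the sum exactly when `ψ` is nonzero
  -- there.
  by_cases h : ψ (γ⁻¹ * η) = 0 <;> simp [htranslate, Finsupp.single_apply, hmul, h]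

/-- Source and range sums agree as `ℂ` is commutative, and they are nonnegative reals, hence equal
to their norms. -/
theorem sobolevNorm_complex {ℓ : Γ → ℝ} (hℓ : ∀ γ, 0 ≤ ℓ γ) (p : ℕ) (φ : Γ →₀ ℂ) :
    sobolevNorm (trivialAction Γ ℂ) ℓ p φ = groupSobolevNorm ℓ p φ := by
  have h : ∀ r : Γ → ℂ → ℂ, (∀ γ c, r γ c = ((‖c‖ ^ 2 * (1 + ℓ γ) ^ (2 * p) : ℝ) : ℂ)) →
      √‖φ.sum r‖ = groupSobolevNorm ℓ p φ := by
    intro r hr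
    obtain rfl : r = _ := funext fun γ => funext (hr γ)
    rw [groupSobolevNorm, Finsupp.sum, Finsupp.sum, ← Complex.ofReal_sum, Complex.norm_real,
      Real.norm_of_nonneg]
    exact Finset.sum_nonneg fun γ _ =>
      mul_nonneg (sq_nonneg _) (pow_nonneg (by linarith [hℓ γ]) _)
  rw [sobolevNorm, sobolevNormSource, sobolevNormRange, h, h, max_self]
  · intro γ c
    have := Complex.mul_conj' c
    push_cast
    rw [smul_eq_mul, mul_comm, ← this]
    rfl
  · intro γ c
    have := Complex.conj_mul' c
    push_cast
    rw [smul_eq_mul, mul_comm, ← this]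
    rfl

/-- The reduced norm of the trivial action on `ℂ` is that of `C_r^*(Γ)`. -/
theorem reducedNorm_complex (φ : Γ →₀ ℂ) :
    reducedNorm (trivialAction Γ ℂ) φ = ENNReal.ofReal (groupReducedNorm φ) := by
  refine le_antisymm ?_ ?_
  · refine (reducedNorm_le_ofReal_iff _ _ (norm_nonneg _)).mpr ?_
    intro ξ hξ
    rw [← norm_toEllTwo] at hξ ⊢
    rw [← leftRegular_toEllTwo]
    exact ContinuousLinearMap.unit_le_opNorm _ _ hξ
  -- If the supremum is finite, it is a real bound `K` on the unit ball of `C_c(Γ)`; density and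
  -- rescaling extend it to `ℓ²(Γ)`.
  · rcases eq_or_ne (reducedNorm (trivialAction Γ ℂ) φ) ⊤ with htop | htop
    · exact htop ▸ le_top
    rw [← ENNReal.ofReal_toReal htop]
    set K := (reducedNorm (trivialAction Γ ℂ) φ).toReal
    have hK : 0 ≤ K := ENNReal.toReal_nonneg
    have hunit := (reducedNorm_le_ofReal_iff _ _ hK).mp (ENNReal.ofReal_toReal htop).ge
    refine ENNReal.ofReal_le_ofReal (ContinuousLinearMap.opNorm_le_bound _ hK fun v => ?_)
    refine denseRange_toEllTwo.induction_on v
      (isClosed_le (by fun_prop) (by fun_prop)) fun ψ => ?_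
    rcases eq_or_ne (toEllTwo ψ) 0 with h0 | h0
    · simp [h0]
    have hpos : 0 < ‖toEllTwo ψ‖ := norm_pos_iff.mpr h0
    have h := hunit (((‖toEllTwo ψ‖⁻¹ : ℝ) : ℂ) • ψ)
    rw [← norm_toEllTwo, ← norm_toEllTwo, ← leftRegular_toEllTwo, toEllTwo_smul, map_smul,
      norm_smul, norm_smul, Complex.norm_real, norm_inv, norm_norm,
      inv_mul_cancel₀ hpos.ne', inv_mul_le_iff₀ hpos, mul_comm] at h
    exact h le_rfl

theorem actionHasRD_complex_iff {ℓ : Γ → ℝ} (hℓ : ∀ γ, 0 ≤ ℓ γ) :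
    ActionHasRD (trivialAction Γ ℂ) ℓ ↔ GroupHasRD ℓ := by
  unfold ActionHasRD GroupHasRD
  refine exists_congr fun C => and_congr_right fun hC => exists_congr fun p =>
    forall_congr' fun φ => ?_
  rw [reducedNorm_complex, sobolevNorm_complex hℓ]
  exact ENNReal.ofReal_le_ofReal_iff (mul_nonneg hC.le (Real.sqrt_nonneg _))

end Scalar

/-- Evaluation at a point of `X`, as a character of `C₀(X)`. -/
def evalZeroAtInfty {X : Type*} [TopologicalSpace X] (x : X) :
    ZeroAtInftyContinuousMap X ℂ →⋆ₙₐ[ℂ] ℂ where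
  toFun f := f x
  map_smul' _ _ := rfl
  map_zero' := rfl
  map_add' _ _ := rfl
  map_mul' _ _ := rfl
  map_star' _ := rfl

/-- Evaluation at a point of `X`, as a character of `C(X)`. -/
def evalContinuousMap {X : Type*} [TopologicalSpace X] [CompactSpace X] (x : X) :
    C(X, ℂ) →⋆ₙₐ[ℂ] ℂ where
  toFun f := f x
  map_smul' _ _ := rfl
  map_zero' := rfl
  map_add' _ _ := rfl
  map_mul' _ _ := rfl
  map_star' _ := rfl

end RapidDecay

end

theorem mainTheorem8 {Γ : Type*} [Group Γ] (ℓ : Γ → ℝ)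
    (hℓ : RapidDecay.IsLengthFunction ℓ) :
    (∀ (X : Type*) [TopologicalSpace X] [LocallyCompactSpace X] [T2Space X],
      RapidDecay.GroupHasRD ℓ →
        RapidDecay.ActionHasRD (RapidDecay.trivialAction Γ (ZeroAtInftyContinuousMap X ℂ)) ℓ) ∧
    (∀ (X : Type*) [TopologicalSpace X] [CompactSpace X] [T2Space X] [Nonempty X],
      RapidDecay.ActionHasRD (RapidDecay.trivialAction Γ C(X, ℂ)) ℓ ↔
        RapidDecay.GroupHasRD ℓ) := by

  have hscalar := RapidDecay.actionHasRD_complex_iff hℓ.nonneg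
  refine ⟨fun X _ _ _ h => (hscalar.mpr h).of_norming RapidDecay.evalZeroAtInfty ?_,
    fun X _ _ _ _ => ⟨fun h => hscalar.mp ?_,
      fun h => (hscalar.mpr h).of_norming RapidDecay.evalContinuousMap ?_⟩⟩
  · intro a r hr h
    -- Here `X` may be empty, so `0 ≤ r` does not follow from the pointwise bounds.
    exact (BoundedContinuousFunction.norm_le (f := a.toBCF) hr).mpr h
  -- The embedding by constants is isometric because `X` is nonempty, so that `1` has norm one.
  · exact h.of_isometric (StarAlgHom.toNonUnitalStarAlgHom (StarAlgHom.ofId ℂ C(X, ℂ)))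
      fun c => norm_algebraMap' C(X, ℂ) c
  · intro a r hr h
    exact (ContinuousMap.norm_le a hr).mpr h
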